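/- All graphs are undirected, without loops and multiple edges, and may have an empty vertex set. A class of finite graphs is hereditary if, with every graph $G$, it contains every graph isomorphic to an induced subgraph of $G$. The clique-width of a finite graph $G$ is the least number of labels in an expression that defines $G$ using the following operations: creation of a vertex with label $i$; disjoint union of two labelled graphs; connecting all vertices labelled $i$ with all vertices labelled $j$, where $i\neq j$; renaming label $i$ to label $j$. The linear clique-width of $G$ is the least number of labels in such an expression for $G$ in which, in every disjoint union, at least one of the two operands has only one vertex. (Both are $0$ for the graph without vertices.) Let $\alpha=\alpha_0\alpha_1\alpha_2\ldots$ be an infinite word over $\{0,1\}$. Let $P^\alpha$ be the graph with vertices $v_{i,j}$ ($i,j\in\mathbb{N}=\{0,1,2,\ldots\}$) in which $v_{i,j}$ and $v_{i',j+1}$ are adjacent if and only if either $\alpha_j=0$ and $i=i'$, or $\alpha_j=1$ and $i\neq i'$, and there are no other edges. Let $\mathcal{G}_\alpha$ be the class of all finite graphs that are isomorphic to an induced subgraph of $P^\alpha$. **Theorem.** Let $\alpha$ be an infinite word over $\{0,1\}$ that contains at least one $1$ and is periodic, that is, there is a positive integer $p$ with $\alpha_i=\alpha_{i+p}$ for all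 $i$. Then $\mathcal{G}_\alpha$ is inclusion-minimal among the hereditary classes of finite graphs of unbounded clique-width, and it is also inclusion-minimal among the hereditary classes of finite graphs of unbounded linear clique-width. Moreover, every hereditary class properly contained in $\mathcal{G}_\alpha$ has bounded linear clique-width. -/

import Mathlib

open SimpleGraph

/-- Algebraic expressions over the label set `Fin k`, built from the four clique-width operations. -/
inductive CWExpr (k : ℕ) : Type
  /-- creation of a new vertex with label `i` -/
  | vertex (i : Fin k) : CWExpr k
  /-- disjoint union of two labelled graphs -/
  | union (e f : CWExpr k) : CWExpr k
  /-- connecting all vertices labelled `i` with all vertices labelled `j`, where `i ≠ j` -/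
  | join (i j : Fin k) (hij : i ≠ j) (e : CWExpr k) : CWExpr k
  /-- renaming label `i` to label `j` -/
  | relabel (i j : Fin k) (e : CWExpr k) : CWExpr k

namespace CWExpr

variable {k : ℕ}

/-- The vertex set of the labelled graph defined by an expression. -/
def Verts : CWExpr k → Type
  | vertex _ => Unit
  | union e f => e.Verts ⊕ f.Verts
  | join _ _ _ e => e.Verts
  | relabel _ _ e => e.Verts

/-- The labelling of the labelled graph defined by an expression. -/
def label : (e : CWExpr k) → e.Verts → Fin k
  | vertex i => fun _ => i
  | union e f => Sum.elim e.label f.label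
  | join _ _ _ e => e.label
  | relabel i j e => fun v => if e.label v = i then j else e.label v

/-- The graph defined by an expression (with its labels forgotten). -/
def graph : (e : CWExpr k) → SimpleGraph e.Verts
  | vertex _ => (⊥ : SimpleGraph Unit)
  | union e f => e.graph ⊕g f.graph
  | join i j hij e =>
      { Adj := fun u v => e.graph.Adj u v ∨ (e.label u = i ∧ e.label v = j) ∨
          (e.label u = j ∧ e.label v = i)
        symm := ⟨fun _ _ h => h.imp (fun h => h.symm)
          (fun h => h.symm.imp (fun h => h.symm) (fun h => h.symm))⟩
        loopless := ⟨fun u h => by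
          rcases h with h | ⟨h₁, h₂⟩ | ⟨h₁, h₂⟩
          · exact e.graph.loopless.irrefl u h
          · exact hij (h₁.symm.trans h₂)
          · exact hij (h₂.symm.trans h₁)⟩ }
  | relabel _ _ e => e.graph

/-- The tree of the expression is a single leaf: it creates one vertex and contains no `⊕`. -/
def IsLeaf : CWExpr k → Prop
  | vertex _ => True
  | union _ _ => False
  | join _ _ _ e => e.IsLeaf
  | relabel _ _ e => e.IsLeaf

/-- Linear expressions: the tree of the expression (leaves are vertex creations, internal nodes are
`⊕`-operations) is a caterpillar descending from its root, i.e. at each `⊕`-node at least one of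
the two subtrees is a leaf. -/
def IsLinear : CWExpr k → Prop
  | vertex _ => True
  | union e f => (e.IsLinear ∧ f.IsLeaf) ∨ (e.IsLeaf ∧ f.IsLinear)
  | join _ _ _ e => e.IsLinear
  | relabel _ _ e => e.IsLinear

end CWExpr

/-- Clique-width: the minimum number of labels in an expression defining `G`. The graph without
vertices, which no expression defines, has clique-width `0`. The value is `⊤` only if no
expression defines `G`, i.e. if `G` is infinite. -/
noncomputable def cliqueWidth {V : Type*} (G : SimpleGraph V) : ℕ∞ :=
  ⨅ (k : ℕ) (_ : IsEmpty V ∨ ∃ e : CWExpr k, Nonempty (G ≃g e.graph)), (k : ℕ∞)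

/-- Linear clique-width: the minimum number of labels in a linear expression defining `G`
(`0` for the graph without vertices). -/
noncomputable def linearCliqueWidth {V : Type*} (G : SimpleGraph V) : ℕ∞ :=
  ⨅ (k : ℕ) (_ : IsEmpty V ∨ ∃ e : CWExpr k, e.IsLinear ∧ Nonempty (G ≃g e.graph)), (k : ℕ∞)

/-- Finite (undirected, simple) graphs. A class of finite graphs is a `Set FinGraph`. -/
structure FinGraph where
  /-- the vertex set -/
  V : Type
  /-- the vertex set is finite -/
  finite : Finite V
  /-- the graph itself -/
  graph : SimpleGraph V

/-- A class is hereditary if it contains, with each graph `G`, every graph `H` isomorphic to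
an induced subgraph of `G`. -/
def IsHereditary (X : Set FinGraph) : Prop :=
  ∀ G ∈ X, ∀ H : FinGraph, H.graph.IsIndContained G.graph → H ∈ X

/-- The class has bounded clique-width. -/
def BoundedCliqueWidth (X : Set FinGraph) : Prop :=
  ∃ c : ℕ, ∀ G ∈ X, cliqueWidth G.graph ≤ c

/-- The class has bounded linear clique-width. -/
def BoundedLinearCliqueWidth (X : Set FinGraph) : Prop :=
  ∃ c : ℕ, ∀ G ∈ X, linearCliqueWidth G.graph ≤ c

/-- The disjoint union of infinitely many one-way infinite paths; the vertex `(i, j)` is the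
`j`-th vertex of the `i`-th path, i.e. it lies in row `i` and column `j`. -/
def pathsGraph : SimpleGraph (ℕ × ℕ) where
  Adj u v := u.1 = v.1 ∧ (v.2 = u.2 + 1 ∨ u.2 = v.2 + 1)
  symm := ⟨fun _ _ h => ⟨h.1.symm, h.2.symm⟩⟩
  loopless := ⟨fun _ h => by omega⟩

/-- The vertices `u` and `v` lie in two consecutive columns `j` and `j + 1` with `α j = 1`. -/
def InFlippedColumns (α : ℕ → Fin 2) (u v : ℕ × ℕ) : Prop :=
  (v.2 = u.2 + 1 ∧ α u.2 = 1) ∨ (u.2 = v.2 + 1 ∧ α v.2 = 1)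

/-- The graph `P^α`: for each `j` with `α j = 1`, the edges of `pathsGraph` between the columns
`j` and `j + 1` are complemented. -/
def wordGraph (α : ℕ → Fin 2) : SimpleGraph (ℕ × ℕ) where
  Adj u v := Xor (pathsGraph.Adj u v) (InFlippedColumns α u v)
  symm := ⟨fun u v h => by
    rwa [pathsGraph.adj_comm v u,
      show InFlippedColumns α v u ↔ InFlippedColumns α u v from or_comm]⟩
  loopless := ⟨fun _ h => by
    rcases h with ⟨h, _⟩ | ⟨h | h, _⟩
    · exact pathsGraph.loopless.irrefl _ h
    · omega
    · omega⟩

/-- The class of all finite graphs isomorphic to an induced subgraph of `P^α`. -/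
def wordClass (α : ℕ → Fin 2) : Set FinGraph :=
  {G | G.graph.IsIndContained (wordGraph α)}

/-!
For a periodic word `α` with at least one `1`, two facts have to be shown: `wordClass α` has
unbounded clique-width, and every proper hereditary subclass has bounded linear clique-width. Since
clique-width is at most linear clique-width, both minimality claims follow.

*Unboundedness.* Suppose that an expression with `k` labels defines the box of the first `n` rows
and `N` columns. A subexpression of suitable size (`CWExpr.exists_cut`) yields a set `U` of vertices
that is balanced on the columns `j` with `α j = 1`, while vertices of `U` have at most `k` different
neighbourhoods outside `U`. Edges that leave `U` in column pairs three apart form an induced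
matching, so at most `3k` pairs of consecutive columns contain such edges (`card_mixedPair_le`).
A pair of columns `j, j + 1` with `α j = 1` induces `K_{n,n}` minus a perfect matching, which is
connected; if no edge of it leaves `U`, column `j` lies in `U` or is disjoint from `U`. By balance
both kinds of columns occur, so every row crosses from `U` to its complement, and it does so in one
of the `3k` pairs. As the rows that cross in the same pair and in the same direction have different
neighbourhoods outside `U` (`card_crossing_le`), there are at most `6k²` rows.

*Boundedness.* By periodicity, every graph of `wordClass α` embeds into a box whose number of
columns `m` is a period of `α`. So a hereditary `X` properly contained in `wordClass α` omits some
box with `k` rows and `m` columns, and a graph of `X`, viewed as a set `S` of vertices of `P^α`,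
contains fewer than `k` full rows in every window of `m` columns. Create the vertices of `S` window
by window and row by row, where in each window a row is followed up to its first gap, and the part
after this gap is left to the next stage. At each cut of this order, only `2m + 1` columns have
edges across the cut, and a vertex sees across the cut a vertex of its own row only if this row is
the current one or is full in one of two windows (`row_mem_of_cut`). Hence the number of
neighbourhoods across a cut is bounded, and so is the linear clique-width
(`linearCliqueWidth_le_of_order`).
-/

/-! ### The graphs `P^α` and their boxes -/

theorem wordGraph_adj {α : ℕ → Fin 2} {u v : ℕ × ℕ} : (wordGraph α).Adj u v ↔
    (v.2 = u.2 + 1 ∧ (α u.2 = 1 ↔ u.1 ≠ v.1)) ∨ (u.2 = v.2 + 1 ∧ (α v.2 = 1 ↔ u.1 ≠ v.1)) := by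
  simp only [wordGraph, pathsGraph, InFlippedColumns, Xor]
  by_cases h1 : v.2 = u.2 + 1
  · have h2 : ¬ u.2 = v.2 + 1 := by omega
    simp only [h1, true_and]
    rw [h1] at h2
    simp only [h2, false_and]
    tauto
  · simp only [h1, false_and]
    tauto

/-- The subgraph of `P^α` induced by the first `n` rows and the first `N` columns. -/
def boxGraph (α : ℕ → Fin 2) (n N : ℕ) : FinGraph where
  V := Fin n × Fin N
  finite := inferInstance
  graph := (wordGraph α).comap fun x => (x.1.val, x.2.val)

theorem boxGraph_mem_wordClass (α : ℕ → Fin 2) (n N : ℕ) : boxGraph α n N ∈ wordClass α :=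
  ⟨⟨⟨fun x : Fin n × Fin N => (x.1.val, x.2.val), fun (_ _ : Fin n × Fin N) h =>
    Prod.ext (Fin.ext (congrArg Prod.fst h)) (Fin.ext (congrArg Prod.snd h))⟩, Iff.rfl⟩⟩

/-! ### Linear expressions from vertex orderings -/

namespace CWExpr

/-- The expression `e` defines the graph with vertex set `P ⊆ V`, adjacency relation `R` and
labelling `ℓ`, up to an isomorphism `φ`. The values of `R` and `ℓ` outside `P` are irrelevant. -/
def Defines {k : ℕ} {V : Type*} (e : CWExpr k) (R : V → V → Prop) (P : Set V) (ℓ : V → Fin k) :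
    Prop :=
  ∃ φ : e.Verts → V, Function.Injective φ ∧ Set.range φ = P ∧
    (∀ x y, e.graph.Adj x y ↔ R (φ x) (φ y)) ∧ ∀ x, e.label x = ℓ (φ x)

variable {k : ℕ} {V : Type*}

theorem Defines.congr {e : CWExpr k} {R R' : V → V → Prop} {P : Set V} {ℓ ℓ' : V → Fin k}
    (h : e.Defines R P ℓ) (hR : ∀ x ∈ P, ∀ y ∈ P, (R x y ↔ R' x y)) (hℓ : ∀ x ∈ P, ℓ x = ℓ' x) :
    e.Defines R' P ℓ' := by
  obtain ⟨φ, hi, rfl, ha, hl⟩ := h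
  exact ⟨φ, hi, rfl,
    fun x y => (ha x y).trans (hR _ (Set.mem_range_self x) _ (Set.mem_range_self y)),
    fun x => (hl x).trans (hℓ _ (Set.mem_range_self x))⟩

theorem defines_vertex (a : V) (i : Fin k) : (vertex i).Defines (fun _ _ : V => False) {a}
    (fun _ => i) :=
  ⟨fun _ => a, fun (_ _ : Unit) _ => rfl, by
    ext x; exact ⟨fun ⟨_, h⟩ => h.symm, fun h => ⟨(() : Unit), h.symm⟩⟩,
    fun _ _ => Iff.rfl, fun _ => rfl⟩

theorem Defines.union_vertex [DecidableEq V] {e : CWExpr k} {R : V → V → Prop} {P : Set V}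
    {ℓ : V → Fin k} (h : e.Defines R P ℓ) {a : V} (ha : a ∉ P) (i : Fin k) :
    (e.union (vertex i)).Defines (fun x y => x ≠ a ∧ y ≠ a ∧ R x y) (insert a P)
      (fun x => if x = a then i else ℓ x) := by
  obtain ⟨φ, hi, rfl, hadj, hl⟩ := h
  have hne : ∀ x, φ x ≠ a := fun x hx => ha ⟨x, hx⟩
  refine ⟨Sum.elim φ (fun _ => a), ?_, ?_, ?_, ?_⟩
  · rintro (x | x) (y | y) hxy
    · exact congrArg _ (hi hxy)
    · exact (hne x hxy).elim
    · exact (hne y hxy.symm).elim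
    · rfl
  · ext x
    constructor
    · rintro ⟨y | y, rfl⟩
      · exact Or.inr ⟨y, rfl⟩
      · exact Or.inl rfl
    · rintro (rfl | ⟨y, rfl⟩)
      · exact ⟨Sum.inr (() : Unit), rfl⟩
      · exact ⟨Sum.inl y, rfl⟩
  · rintro (x | x) (y | y)
    · exact (hadj x y).trans
        ⟨fun h => ⟨hne x, hne y, h⟩, fun h => h.2.2⟩
    · refine iff_of_false ?_ fun h => h.2.1 rfl
      change ¬ (e.graph ⊕g (⊥ : SimpleGraph Unit)).Adj (Sum.inl x) (Sum.inr y)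
      simp
    · refine iff_of_false ?_ fun h => h.1 rfl
      change ¬ (e.graph ⊕g (⊥ : SimpleGraph Unit)).Adj (Sum.inr x) (Sum.inl y)
      simp
    · exact iff_of_false (fun h => h) fun h => h.1 rfl
  · rintro (x | x)
    · simpa [label, hne] using hl x
    · simp [label]

theorem Defines.exists_join {a : Fin k} {P : Set V} {ℓ : V → Fin k} (L : List (Fin k))
    (hL : a ∉ L) {e : CWExpr k} (he : e.IsLinear) {R : V → V → Prop} (h : e.Defines R P ℓ) :
    ∃ e' : CWExpr k, e'.IsLinear ∧
      e'.Defines (fun x y => R x y ∨ (ℓ x ∈ L ∧ ℓ y = a) ∨ (ℓ x = a ∧ ℓ y ∈ L)) P ℓ := by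
  induction L with
  | nil => exact ⟨e, he, h.congr (by simp) (by simp)⟩
  | cons i L ih =>
    rw [List.mem_cons, not_or] at hL
    obtain ⟨e', he', φ, hi, hP, hadj, hl⟩ := ih hL.2
    refine ⟨e'.join i a (Ne.symm hL.1), he', φ, hi, hP, fun (x y : e'.Verts) => ?_, hl⟩
    change (e'.graph.Adj x y ∨ (e'.label x = i ∧ e'.label y = a) ∨
      (e'.label x = a ∧ e'.label y = i)) ↔ _
    simp only [List.mem_cons, hadj, hl]
    tauto

/-- A sequence of renamings realizes `g` on the labels of `L`, as long as `g` maps them to labels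
that do not occur in `L`, so that no vertex is renamed twice. -/
theorem Defines.exists_relabel {P : Set V} {ℓ : V → Fin k} {R : V → V → Prop} (g : Fin k → Fin k)
    (L : List (Fin k)) (hL : ∀ i ∈ L, g i ∉ L) {e : CWExpr k} (he : e.IsLinear)
    (h : e.Defines R P ℓ) :
    ∃ e' : CWExpr k, e'.IsLinear ∧
      e'.Defines R P (fun x => if ℓ x ∈ L then g (ℓ x) else ℓ x) := by
  induction L with
  | nil => exact ⟨e, he, by simpa using h⟩
  | cons i L ih =>
    obtain ⟨e', he', φ, hi, hP, hadj, hl⟩ := ih fun j hj hgj =>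
      hL j (List.mem_cons_of_mem _ hj) (List.mem_cons_of_mem _ hgj)
    refine ⟨e'.relabel i (g i), he', φ, hi, hP, hadj, fun (x : e'.Verts) => ?_⟩
    change (if e'.label x = i then g i else e'.label x) = _
    simp only [hl, List.mem_cons]
    by_cases h1 : ℓ (φ x) ∈ L
    · have h2 : g (ℓ (φ x)) ≠ i := fun h2 =>
        hL _ (List.mem_cons_of_mem _ h1) (by rw [h2]; exact List.mem_cons_self)
      simp [h1, h2]
    · by_cases h3 : ℓ (φ x) = i
      · rw [← h3]
        simp [h1]
      · simp [h1, h3]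

/-- The labels are split into two copies of `γ` and one further label: the new vertex `a` enters
with the further label, all vertices are then renamed into the second copy, and from there back
into the first one. -/
theorem Defines.exists_insert [DecidableEq V] {γ : Type*} [Fintype γ]
    (σ : Option (γ ⊕ γ) ≃ Fin k) (c : V → γ)
    {e : CWExpr k} (he : e.IsLinear) {G : SimpleGraph V} {P : Set V}
    (h : e.Defines G.Adj P (fun x => σ (some (Sum.inl (c x))))) {a : V} (ha : a ∉ P)
    (hG : ∀ u ∈ P, ∀ u' ∈ P, c u = c u' → (G.Adj u a ↔ G.Adj u' a)) (f : γ → γ) (i : γ) :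
    ∃ e' : CWExpr k, e'.IsLinear ∧ e'.Defines G.Adj (insert a P)
      (fun x => σ (some (Sum.inl (if x = a then i else f (c x))))) := by
  classical
  have hne : ∀ x ∈ P, x ≠ a := fun x hx hxa => ha (hxa ▸ hx)
  have he₀ : (e.union (vertex (σ none))).IsLinear := Or.inl ⟨he, trivial⟩
  obtain ⟨e₁, he₁, h₁⟩ := (h.union_vertex ha (σ none)).exists_join
    ((Finset.univ.filter fun j : γ => ∃ u ∈ P, c u = j ∧ G.Adj u a).toList.map
      fun j => σ (some (Sum.inl j))) (a := σ none) (by simp) he₀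
  obtain ⟨e₂, he₂, h₂⟩ := h₁.exists_relabel
    (fun j => σ (some (Sum.inr (match σ.symm j with
      | some (Sum.inl j) => f j
      | _ => i)))) (σ none :: (Finset.univ.toList.map fun j => σ (some (Sum.inl j)))) (by simp) he₁
  obtain ⟨e₃, he₃, h₃⟩ := h₂.exists_relabel
    (fun j => σ (some (Sum.inl (match σ.symm j with
      | some (Sum.inr j) => j
      | _ => i)))) (Finset.univ.toList.map fun j => σ (some (Sum.inr j))) (by simp) he₂
  refine ⟨e₃, he₃, h₃.congr ?_ ?_⟩
  · intro x hx y hy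
    rcases hx with rfl | hx <;> rcases hy with rfl | hy
    · simp
    · have := hne y hy
      simp only [this, if_true, if_false]
      simp only [ne_eq, not_true, false_and, false_or, true_and, List.mem_map, Finset.mem_toList,
        Finset.mem_filter, Finset.mem_univ, EmbeddingLike.apply_eq_iff_eq, reduceCtorEq, and_false,
        exists_false, Option.some.injEq, Sum.inl.injEq, exists_eq_right]
      rw [G.adj_comm x y]
      exact ⟨fun ⟨u, hu, huy, hux⟩ => (hG u hu y hy huy).1 hux, fun h => ⟨y, hy, rfl, h⟩⟩
    · have := hne x hx
      simp only [this, if_true, if_false]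
      simp only [ne_eq, not_true, false_and, and_false, false_or, and_true, List.mem_map,
        Finset.mem_toList, or_false,
        Finset.mem_filter, Finset.mem_univ, true_and, EmbeddingLike.apply_eq_iff_eq, reduceCtorEq,
        Option.some.injEq, Sum.inl.injEq, exists_eq_right]
      exact ⟨fun ⟨u, hu, huy, hux⟩ => (hG u hu x hx huy).1 hux, fun h => ⟨x, hx, rfl, h⟩⟩
    · simp [hne x hx, hne y hy]
  · intro x hx
    rcases hx with rfl | hx
    · simp
    · simp [hne x hx]

end CWExpr

/-- If the vertices can be ordered such that for every cut of the ordering the vertices of the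
initial segment have at most `|γ|` different neighbourhoods in the final segment (`c` encodes
them), then the linear clique-width is at most `2|γ| + 1`. -/
theorem linearCliqueWidth_le_of_order {V γ L : Type*} [Finite V] [Fintype γ] [LinearOrder L]
    (G : SimpleGraph V) (f : V → L) (hf : Function.Injective f)
    (h : ∀ a, ∃ c : V → γ, ∀ u u', f u ≤ f a → f u' ≤ f a → c u = c u' →
      ∀ w, f a < f w → (G.Adj u w ↔ G.Adj u' w)) :
    linearCliqueWidth G ≤ (2 * Fintype.card γ + 1 : ℕ) := by
  classical
  let _ : LinearOrder V := LinearOrder.lift' f hf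
  have hlt : ∀ x y : V, x < y ↔ f x < f y := fun _ _ => Iff.rfl
  have hle : ∀ x y : V, x ≤ y ↔ f x ≤ f y := fun _ _ => Iff.rfl
  simp only [← hlt, ← hle] at h
  have := Fintype.ofFinite V
  obtain ⟨σ⟩ : Nonempty (Option (γ ⊕ γ) ≃ Fin (2 * Fintype.card γ + 1)) :=
    ⟨Fintype.equivFinOfCardEq (by simp [two_mul])⟩
  have key : ∀ s : Finset V, s.Nonempty → IsLowerSet (s : Set V) →
      ∃ (e : CWExpr (2 * Fintype.card γ + 1)) (c : V → γ), e.IsLinear ∧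
        e.Defines G.Adj s (fun x => σ (some (Sum.inl (c x)))) ∧
        ∀ u ∈ s, ∀ u' ∈ s, c u = c u' → ∀ w, w ∉ s → (G.Adj u w ↔ G.Adj u' w) := by
    intro s
    induction s using Finset.induction_on_max with
    | empty => intro h; simp at h
    | insert a s hs ih =>
      intro _ hlow
      obtain ⟨c', hc'⟩ := h a
      have hout : ∀ w, w ∉ insert a s → a < w := fun w hw => by
        by_contra hcon
        exact hw (by exact_mod_cast hlow (not_lt.1 hcon) (by simp))
      have has : a ∉ s := fun ha => lt_irrefl _ (hs a ha)
      rcases s.eq_empty_or_nonempty with rfl | hne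
      · refine ⟨CWExpr.vertex (σ (some (Sum.inl (c' a)))), c', trivial, ?_, ?_⟩
        · have := CWExpr.defines_vertex a (σ (some (Sum.inl (c' a))))
          simp only [insert_empty_eq, Finset.coe_singleton]
          exact this.congr (by simp) (by simp)
        · simp
      · obtain ⟨e, c, he, hdef, hc⟩ := ih hne fun x y hyx hx => by
          have h1 : y ∈ ((insert a s : Finset V) : Set V) := hlow hyx (by simp_all)
          have h2 : y ≠ a := (lt_of_le_of_lt hyx (hs x (by simpa using hx))).ne
          simpa [h2] using h1
        -- A class of old labels is represented by one of its vertices, whose code becomes the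
        -- new label of the whole class.
        let r : γ → V := fun i => if hi : ∃ u ∈ s, c u = i then hi.choose else a
        have hr : ∀ u ∈ s, r (c u) ∈ s ∧ c (r (c u)) = c u := fun u hu => by
          have hi : ∃ u' ∈ s, c u' = c u := ⟨u, hu, rfl⟩
          simp only [r, dif_pos hi]
          exact hi.choose_spec
        obtain ⟨e', he', hdef'⟩ := hdef.exists_insert σ c he (a := a) (by simpa using has)
          (fun u hu u' hu' huu => hc u hu u' hu' huu a has) (fun i => c' (r i)) (c' a)
        refine ⟨e', fun x => if x = a then c' a else c' (r (c x)), he', by simpa using hdef', ?_⟩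
        have hrep : ∀ u ∈ insert a s, ∃ v, v ≤ a ∧
            (if u = a then c' a else c' (r (c u))) = c' v ∧
            ∀ w, w ∉ insert a s → (G.Adj u w ↔ G.Adj v w) := by
          intro u hu
          by_cases hua : u = a
          · exact ⟨a, le_rfl, by simp [hua], by simp [hua]⟩
          · have hus : u ∈ s := by simpa [hua] using hu
            obtain ⟨h1, h2⟩ := hr u hus
            exact ⟨r (c u), (hs _ h1).le, by simp [hua], fun w hw =>
              hc u hus _ h1 h2.symm w fun h => hw (Finset.mem_insert_of_mem h)⟩
        intro u hu u' hu' heq w hw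
        obtain ⟨v, hva, hv, hvw⟩ := hrep u hu
        obtain ⟨v', hva', hv', hvw'⟩ := hrep u' hu'
        rw [hvw w hw, hvw' w hw]
        exact hc' v v' hva hva' (by rw [← hv, ← hv']; exact heq) w (hout w hw)
  unfold linearCliqueWidth
  refine iInf₂_le (2 * Fintype.card γ + 1) ?_
  rcases isEmpty_or_nonempty V with hV | hV
  · exact Or.inl hV
  · obtain ⟨e, c, he, ⟨φ, hi, hrange, hadj, -⟩, -⟩ := key Finset.univ Finset.univ_nonempty
      (by simpa using isLowerSet_univ)
    have hsurj : Function.Surjective φ := Set.range_eq_univ.1 (by simpa using hrange)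
    exact Or.inr ⟨e, he, ⟨RelIso.symm ⟨Equiv.ofBijective φ ⟨hi, hsurj⟩, fun {x y} =>
      (hadj x y).symm⟩⟩⟩

/-! ### Clique-width of the word classes is unbounded -/

theorem ncard_image_inter {α β : Type*} {f : α → β} (hf : Function.Injective f) (U : Set α)
    (A : Set β) : (f '' U ∩ A).ncard = (U ∩ f ⁻¹' A).ncard := by
  rw [← Set.ncard_image_of_injective _ hf, Set.image_inter_preimage]

theorem ncard_le_ncard_preimage_inl_add {α β : Type*} [Finite α] [Finite β] (A : Set (α ⊕ β)) :
    A.ncard ≤ (Sum.inl ⁻¹' A : Set α).ncard + (Sum.inr ⁻¹' A : Set β).ncard := by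
  rw [← Set.univ_inter (Sum.inl ⁻¹' A), ← Set.univ_inter (Sum.inr ⁻¹' A),
    ← ncard_image_inter Sum.inl_injective, ← ncard_image_inter Sum.inr_injective]
  refine le_trans (Set.ncard_le_ncard ?_ (Set.toFinite _)) (Set.ncard_union_le _ _)
  rintro (x | x) hx
  · exact Or.inl ⟨⟨x, trivial, rfl⟩, hx⟩
  · exact Or.inr ⟨⟨x, trivial, rfl⟩, hx⟩

namespace CWExpr

instance finite_verts {k : ℕ} (e : CWExpr k) : Finite e.Verts := by
  induction e with
  | vertex i => exact inferInstanceAs (Finite Unit)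
  | union e f he hf => exact @Finite.instSum _ _ he hf
  | join i j hij e he => exact he
  | relabel i j e he => exact he

/-- Every expression has a subexpression whose vertex set `U` contains at least `s` and fewer than
`2s` vertices of a given set `A`. Vertices with the same label there have the same neighbours
outside `U`. -/
theorem exists_cut {k : ℕ} (e : CWExpr k) (A : Set e.Verts) {s : ℕ} (hs : 1 ≤ s)
    (hA : s ≤ A.ncard) :
    ∃ (U : Set e.Verts) (c : e.Verts → Fin k), s ≤ (U ∩ A).ncard ∧ (U ∩ A).ncard < 2 * s ∧
      ∀ u ∈ U, ∀ u' ∈ U, c u = c u' →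
        e.label u = e.label u' ∧ ∀ w, w ∉ U → (e.graph.Adj u w ↔ e.graph.Adj u' w) := by
  induction e with
  | vertex i =>
    refine ⟨Set.univ, (vertex i).label, by simpa using hA, ?_, fun u _ u' _ h => ⟨h, by simp⟩⟩
    have : (Set.univ ∩ A).ncard ≤ 1 := by
      rw [Set.ncard_le_one]
      exact fun (_ : Unit) _ (_ : Unit) _ => rfl
    omega
  | union e f he hf =>
    by_cases hlt : A.ncard < 2 * s
    · exact ⟨Set.univ, (e.union f).label, by simpa using hA, by simpa using hlt,
        fun u _ u' _ h => ⟨h, by simp⟩⟩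
    have hsum : A.ncard ≤ (Sum.inl ⁻¹' A : Set e.Verts).ncard +
        (Sum.inr ⁻¹' A : Set f.Verts).ncard :=
      ncard_le_ncard_preimage_inl_add (α := e.Verts) (β := f.Verts) A
    rcases (show s ≤ (Sum.inl ⁻¹' A : Set e.Verts).ncard ∨
        s ≤ (Sum.inr ⁻¹' A : Set f.Verts).ncard by omega) with h | h
    · obtain ⟨U, c, h1, h2, h3⟩ := he _ h
      have hU := ncard_image_inter (Sum.inl_injective (α := e.Verts) (β := f.Verts)) U A
      refine ⟨Sum.inl '' U, Sum.elim c f.label, h1.trans_eq hU.symm, hU.trans_lt h2, ?_⟩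
      rintro _ ⟨u, hu, rfl⟩ _ ⟨u', hu', rfl⟩ hc
      obtain ⟨h4, h5⟩ := h3 u hu u' hu' hc
      refine ⟨h4, ?_⟩
      rintro (w | w) hw
      · simpa [graph] using h5 w fun h => hw ⟨w, h, rfl⟩
      · simp [graph]
    · obtain ⟨U, c, h1, h2, h3⟩ := hf _ h
      have hU := ncard_image_inter (Sum.inr_injective (α := e.Verts) (β := f.Verts)) U A
      refine ⟨Sum.inr '' U, Sum.elim e.label c, h1.trans_eq hU.symm, hU.trans_lt h2, ?_⟩
      rintro _ ⟨u, hu, rfl⟩ _ ⟨u', hu', rfl⟩ hc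
      obtain ⟨h4, h5⟩ := h3 u hu u' hu' hc
      refine ⟨h4, ?_⟩
      rintro (w | w) hw
      · simp [graph]
      · simpa [graph] using h5 w fun h => hw ⟨w, h, rfl⟩
  | join i j hij e he =>
    obtain ⟨U, c, h1, h2, h3⟩ := he A hA
    refine ⟨U, c, h1, h2, fun u hu u' hu' hc => ⟨(h3 u hu u' hu' hc).1, fun w hw => ?_⟩⟩
    simp only [graph, (h3 u hu u' hu' hc).1, (h3 u hu u' hu' hc).2 w hw]
  | relabel i j e he =>
    obtain ⟨U, c, h1, h2, h3⟩ := he A hA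
    refine ⟨U, c, h1, h2, fun u hu u' hu' hc => ⟨?_, (h3 u hu u' hu' hc).2⟩⟩
    simp only [label, (h3 u hu u' hu' hc).1]

end CWExpr

section Cut

/- Throughout, `U` is a set of vertices of the box with `n` rows and `N` columns, whose vertices
have at most `k` neighbourhoods in the rest of the box, encoded by `c`. -/

/-- The edges of `P^α` between the columns `j` and `j + 1`, within the first `n` rows, meet both
`U` and its complement. -/
def MixedPair (α : ℕ → Fin 2) (n : ℕ) (U : Set (ℕ × ℕ)) (j : ℕ) : Prop :=
  ∃ i < n, ∃ i' < n, (wordGraph α).Adj (i, j) (i', j + 1) ∧ ¬((i, j) ∈ U ↔ (i', j + 1) ∈ U)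

variable {α : ℕ → Fin 2} {n N k : ℕ} {U : Set (ℕ × ℕ)}

theorem mem_succ_iff_of_not_mixedPair (hn : 3 ≤ n) {j : ℕ} (hj : ¬ MixedPair α n U j) {i : ℕ}
    (hi : i < n) : (i, j) ∈ U ↔ (i, j + 1) ∈ U := by
  have h : ∀ i < n, ∀ i' < n, (wordGraph α).Adj (i, j) (i', j + 1) →
      ((i, j) ∈ U ↔ (i', j + 1) ∈ U) := by
    intro i hi i' hi' hadj
    by_contra hcon
    exact hj ⟨i, hi, i', hi', hadj, hcon⟩
  by_cases hα : α j = 1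
  · -- The columns induce `K_{n,n}` minus a perfect matching: walk along a path of length three.
    obtain ⟨l, hl, hli⟩ : ∃ l < n, l ≠ i := by
      by_cases h0 : i = 0
      · exact ⟨1, by omega, by omega⟩
      · exact ⟨0, by omega, by omega⟩
    obtain ⟨l', hl', hli', hll'⟩ : ∃ l' < n, l' ≠ i ∧ l' ≠ l := by
      by_contra! hcon
      have h0 := hcon 0 (by omega)
      have h1 := hcon 1 (by omega)
      have h2 := hcon 2 (by omega)
      omega
    rw [h i hi l hl (wordGraph_adj.2 (by simp [hα, hli.symm])),
      ← h l' hl' l hl (wordGraph_adj.2 (by simp [hα, hll'])),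
      h l' hl' i hi (wordGraph_adj.2 (by simp [hα, hli']))]
  · exact h i hi i hi (wordGraph_adj.2 (by simp [hα]))

theorem mem_iff_of_not_mixedPair (hn : 3 ≤ n) {j : ℕ} (hj : ¬ MixedPair α n U j) (hα : α j = 1)
    {i i' : ℕ} (hi : i < n) (hi' : i' < n) : (i, j) ∈ U ↔ (i', j) ∈ U := by
  by_cases hii : i = i'
  · rw [hii]
  · rw [mem_succ_iff_of_not_mixedPair hn hj hi]
    by_contra hcon
    exact hj ⟨i', hi', i, hi, wordGraph_adj.2 (by simp [hα, Ne.symm hii]), fun h => hcon h.symm⟩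

variable {c : ℕ × ℕ → Fin k}
  (hc : ∀ u ∈ U, u.1 < n → u.2 < N → ∀ u' ∈ U, u'.1 < n → u'.2 < N → c u = c u' →
    ∀ w, w ∉ U → w.1 < n → w.2 < N → ((wordGraph α).Adj u w ↔ (wordGraph α).Adj u' w))

include hc in
/-- Edges between `U` and its complement in column pairs that are three apart form an induced
matching, so their ends in `U` have different neighbourhoods outside `U`. -/
theorem card_mixedPair_le (M : Finset ℕ) (hM : ∀ j ∈ M, j + 1 < N ∧ MixedPair α n U j) :
    M.card ≤ 3 * k := by
  classical
  by_contra! hcard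
  obtain ⟨r, -, hr⟩ := Finset.exists_lt_card_fiber_of_mul_lt_card_of_maps_to
    (s := M) (t := Finset.range 3) (f := fun j => j % 3) (n := k)
    (fun j _ => Finset.mem_range.2 (Nat.mod_lt _ (by omega))) (by simpa using hcard)
  have hedge : ∀ j : ℕ, ∃ u w : ℕ × ℕ, j ∈ M → u ∈ U ∧ u.1 < n ∧ u.2 < N ∧ w ∉ U ∧ w.1 < n ∧
      w.2 < N ∧ (wordGraph α).Adj u w ∧ (u.2 = j ∨ u.2 = j + 1) ∧ (w.2 = j ∨ w.2 = j + 1) := by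
    intro j
    by_cases hj : j ∈ M
    · obtain ⟨hjN, i, hi, i', hi', hadj, hU⟩ := hM j hj
      by_cases h : (i, j) ∈ U
      · exact ⟨(i, j), (i', j + 1), fun _ => ⟨h, hi, by simp; omega, by tauto, hi', hjN, hadj,
          by simp, by simp⟩⟩
      · exact ⟨(i', j + 1), (i, j), fun _ => ⟨by tauto, hi', hjN, h, hi, by simp; omega, hadj.symm,
          by simp, by simp⟩⟩
    · exact ⟨(0, 0), (0, 0), fun h => (hj h).elim⟩
  choose u w huw using hedge
  obtain ⟨j, hj, j', hj', hne, heq⟩ := Finset.exists_ne_map_eq_of_card_lt_of_maps_to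
    (s := M.filter fun j => j % 3 = r) (t := Finset.univ) (f := fun j => c (u j)) (by simpa using hr)
    (fun _ _ => Finset.mem_coe.2 (Finset.mem_univ _))
  rw [Finset.mem_filter] at hj hj'
  obtain ⟨h1, h2, h3, h4, h5, h6, h7, h8, h9⟩ := huw j hj.1
  obtain ⟨h1', h2', h3', -, -, -, -, h8', -⟩ := huw j' hj'.1
  rw [hc _ h1 h2 h3 _ h1' h2' h3' heq _ h4 h5 h6, wordGraph_adj] at h7
  omega

include hc in
theorem card_crossing_le {j j' : ℕ} (hjN : j < N) (hjN' : j' < N) (hjj : j' = j + 1 ∨ j = j' + 1)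
    (I : Finset ℕ) (hI : ∀ i ∈ I, i < n ∧ (i, j) ∈ U ∧ (i, j') ∉ U) : I.card ≤ k := by
  by_contra! hcard
  obtain ⟨i, hi, i', hi', hne, heq⟩ := Finset.exists_ne_map_eq_of_card_lt_of_maps_to
    (s := I) (t := Finset.univ) (f := fun i => c (i, j)) (by simpa using hcard)
    (fun _ _ => Finset.mem_coe.2 (Finset.mem_univ _))
  obtain ⟨h1, h2, h3⟩ := hI i hi
  obtain ⟨h1', h2', -⟩ := hI i' hi'
  have := hc _ h2 h1 hjN _ h2' h1' hjN heq _ h3 h1 hjN'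
  simp only [wordGraph_adj, ne_eq, not_true, Ne.symm hne, not_false_eq_true, iff_true,
    iff_false] at this
  rcases hjj with rfl | rfl
  · simp only [true_and, show ¬ j = j + 1 + 1 by omega, false_and, or_false] at this
    tauto
  · simp only [true_and, show ¬ j' = j' + 1 + 1 by omega, false_and, false_or] at this
    tauto

theorem exists_crossing {i a b : ℕ} (hab : a ≤ b) (hU : ¬((i, a) ∈ U ↔ (i, b) ∈ U)) :
    ∃ j, j < b ∧ ¬((i, j) ∈ U ↔ (i, j + 1) ∈ U) := by
  by_contra! hcon
  refine hU ?_
  induction b, hab using Nat.le_induction with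
  | base => rfl
  | succ b _ ih =>
    rw [← hcon b (by omega)]
    by_contra h
    exact h (by_contra fun h' => h' (ih h' fun j hj => hcon j (by omega)))

include hc in
/-- If some column is contained in `U` and some column is disjoint from `U`, then every row
crosses from `U` to its complement, and it does so in one of the few mixed pairs. -/
theorem rows_le_of_full_columns (hn : 3 ≤ n) {a b : ℕ} (ha : a < N) (hb : b < N)
    (haU : ∀ i < n, (i, a) ∈ U) (hbU : ∀ i < n, (i, b) ∉ U) : n ≤ 2 * k * (3 * k) := by
  classical
  have hcross : ∀ i < n, ∃ j, j + 1 < N ∧ ¬((i, j) ∈ U ↔ (i, j + 1) ∈ U) := by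
    intro i hi
    have h1 := haU i hi
    have h2 := hbU i hi
    rcases le_total a b with hab | hab
    · obtain ⟨j, hj, h⟩ := exists_crossing hab (U := U) (i := i) (by tauto)
      exact ⟨j, by omega, h⟩
    · obtain ⟨j, hj, h⟩ := exists_crossing hab (U := U) (i := i) (by tauto)
      exact ⟨j, by omega, h⟩
  choose! g hg using hcross
  let M := (Finset.range n).image g
  have hM : M.card ≤ 3 * k := by
    refine card_mixedPair_le hc M fun j hj => ?_
    obtain ⟨i, hi, rfl⟩ := Finset.mem_image.1 hj
    have hi := Finset.mem_range.1 hi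
    refine ⟨(hg i hi).1, ?_⟩
    by_contra hcon
    exact (hg i hi).2 (mem_succ_iff_of_not_mixedPair hn hcon hi)
  have hfib : ∀ j ∈ M, ((Finset.range n).filter fun i => g i = j).card ≤ 2 * k := by
    intro j hj
    obtain ⟨i₀, hi₀, rfl⟩ := Finset.mem_image.1 hj
    have hN := (hg i₀ (Finset.mem_range.1 hi₀)).1
    rw [← Finset.card_filter_add_card_filter_not (fun i => (i, g i₀) ∈ U), two_mul]
    refine add_le_add (card_crossing_le hc (by omega) hN (Or.inl rfl) _ ?_)
      (card_crossing_le hc hN (by omega) (Or.inr rfl) _ ?_)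
    · intro i hi
      simp only [Finset.mem_filter, Finset.mem_range] at hi
      have := (hg i hi.1.1).2
      rw [hi.1.2] at this
      exact ⟨hi.1.1, hi.2, by tauto⟩
    · intro i hi
      simp only [Finset.mem_filter, Finset.mem_range] at hi
      have := (hg i hi.1.1).2
      rw [hi.1.2] at this
      exact ⟨hi.1.1, by tauto, hi.2⟩
  calc n = (Finset.range n).card := (Finset.card_range n).symm
    _ ≤ 2 * k * M.card := Finset.card_le_mul_card_image_of_maps_to
        (fun i hi => Finset.mem_image_of_mem g hi) _ hfib
    _ ≤ 2 * k * (3 * k) := Nat.mul_le_mul_left _ hM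

include hc in
/-- All but at most `3k` of the columns `j ∈ T` are contained in `U` or disjoint from it, because
`α j = 1`. If `U` contains between a third and two thirds of the vertices of these columns, both
kinds occur. -/
theorem rows_le_of_balanced (hn : 3 ≤ n) (T : Finset ℕ) (hT : ∀ j ∈ T, j + 1 < N ∧ α j = 1)
    (hcard : T.card = 9 * k + 2)
    (h1 : n * (3 * k + 1) ≤ (U ∩ (Finset.range n ×ˢ T : Finset (ℕ × ℕ))).ncard)
    (h2 : (U ∩ (Finset.range n ×ˢ T : Finset (ℕ × ℕ))).ncard < 2 * (n * (3 * k + 1))) :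
    n ≤ 2 * k * (3 * k) := by
  classical
  obtain ⟨A, hA⟩ : ∃ A, A = Finset.range n ×ˢ T := ⟨_, rfl⟩
  rw [← hA] at h1 h2
  let M := T.filter fun j => MixedPair α n U j
  have hM : M.card ≤ 3 * k := card_mixedPair_le hc M fun j hj =>
    ⟨(hT j (Finset.mem_filter.1 hj).1).1, (Finset.mem_filter.1 hj).2⟩
  have hMA : (Finset.range n ×ˢ M).card ≤ n * (3 * k) := by
    rw [Finset.card_product, Finset.card_range]
    exact Nat.mul_le_mul_left _ hM
  have hn' : n * (3 * k + 1) = n * (3 * k) + n := by ring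
  obtain ⟨⟨i, a⟩, ⟨haU, haA⟩, haM⟩ : ∃ v, v ∈ U ∩ A ∧ v ∉ Finset.range n ×ˢ M := by
    by_contra! hcon
    have := Set.ncard_le_ncard (s := U ∩ A) (t := ((Finset.range n ×ˢ M : Finset _) : Set (ℕ × ℕ)))
      hcon (Finset.finite_toSet _)
    rw [Set.ncard_coe_finset] at this
    omega
  obtain ⟨⟨i', b⟩, ⟨hbA, hbU⟩, hbM⟩ :
      ∃ v, v ∈ (A : Set (ℕ × ℕ)) \ U ∧ v ∉ Finset.range n ×ˢ M := by
    by_contra! hcon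
    have h3 := Set.ncard_le_ncard (s := (A : Set (ℕ × ℕ)) \ U)
      (t := ((Finset.range n ×ˢ M : Finset _) : Set (ℕ × ℕ))) hcon (Finset.finite_toSet _)
    have h4 := Set.ncard_inter_add_ncard_sdiff_eq_ncard (A : Set (ℕ × ℕ)) U (Finset.finite_toSet _)
    rw [Set.ncard_coe_finset] at h3
    rw [Set.ncard_coe_finset A, hA, Finset.card_product, Finset.card_range, hcard, ← hA,
      Set.inter_comm] at h4
    have : n * (9 * k + 2) = 3 * (n * (3 * k)) + 2 * n := by ring
    omega
  subst hA
  simp only [Finset.coe_product, Set.mem_prod, Finset.mem_coe, Finset.mem_range] at haA hbA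
  simp only [Finset.mem_product, Finset.mem_range, M, Finset.mem_filter] at haM hbM
  have haN := hT a haA.2
  have hbN := hT b hbA.2
  refine rows_le_of_full_columns hc hn (a := a) (b := b) (by omega) (by omega) ?_ ?_
  · exact fun l hl => (mem_iff_of_not_mixedPair hn (by tauto) haN.2 haA.1 hl).1 haU
  · exact fun l hl h => hbU ((mem_iff_of_not_mixedPair hn (by tauto) hbN.2 hl hbA.1).1 h)

end Cut

theorem isEmpty_boxGraph_iso {α : ℕ → Fin 2} {n N k : ℕ} (T : Finset ℕ)
    (hT : ∀ j ∈ T, j + 1 < N ∧ α j = 1) (hcard : T.card = 9 * k + 2) (hn : 3 ≤ n)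
    (hnk : 2 * k * (3 * k) < n) (e : CWExpr k) : IsEmpty ((boxGraph α n N).graph ≃g e.graph) := by
  classical
  refine ⟨fun φ => ?_⟩
  let p : e.Verts → ℕ × ℕ := fun x => ((φ.symm x).1.val, (φ.symm x).2.val)
  have hp : Function.Injective p := fun x y h => by
    exact φ.symm.injective
      (Prod.ext (Fin.ext (congrArg Prod.fst h)) (Fin.ext (congrArg Prod.snd h)))
  have hadj : ∀ x y, e.graph.Adj x y ↔ (wordGraph α).Adj (p x) (p y) := fun x y =>
    φ.symm.map_adj_iff.symm
  have hbox : ∀ v : ℕ × ℕ, v.1 < n → v.2 < N → ∃ x, p x = v := fun v h1 h2 =>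
    ⟨φ ((⟨v.1, h1⟩ : Fin n), (⟨v.2, h2⟩ : Fin N)),
      congrArg (fun z : Fin n × Fin N => (z.1.val, z.2.val)) (φ.symm_apply_apply _)⟩
  have himage : ∀ U : Set e.Verts, (p '' U ∩ ((Finset.range n ×ˢ T : Finset _) : Set (ℕ × ℕ))).ncard
      = (U ∩ p ⁻¹' ((Finset.range n ×ˢ T : Finset _) : Set (ℕ × ℕ))).ncard := fun U => by
    rw [← Set.ncard_image_of_injective _ hp, Set.image_inter_preimage]
  have hs : 1 ≤ n * (3 * k + 1) := Nat.mul_pos (by omega) (by omega)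
  obtain ⟨U, c, h1, h2, h3⟩ := e.exists_cut (p ⁻¹' ((Finset.range n ×ˢ T : Finset _) : Set (ℕ × ℕ)))
    hs (by
      have h := himage Set.univ
      rw [Set.univ_inter] at h
      rw [← h, Set.inter_eq_self_of_subset_right, Set.ncard_coe_finset, Finset.card_product,
        Finset.card_range, hcard]
      · exact Nat.mul_le_mul_left _ (by omega)
      · rintro v hv
        simp only [Finset.coe_product, Set.mem_prod, Finset.mem_coe, Finset.mem_range] at hv
        obtain ⟨x, hx⟩ := hbox v hv.1 (by have := hT _ hv.2; omega)
        exact ⟨x, trivial, hx⟩)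
  obtain ⟨x₀⟩ : Nonempty e.Verts := by
    by_contra hcon
    rw [not_nonempty_iff] at hcon
    simp [Set.eq_empty_of_isEmpty] at h1
    omega
  have : Nonempty e.Verts := ⟨x₀⟩
  have hinv : ∀ x, Function.invFun p (p x) = x := Function.leftInverse_invFun hp
  refine absurd (rows_le_of_balanced (U := p '' U) (c := fun v => c (Function.invFun p v)) ?_ hn T hT
    hcard (by rw [himage]; exact h1) (by rw [himage]; exact h2)) (not_le.2 hnk)
  rintro _ ⟨u, hu, rfl⟩ - - _ ⟨u', hu', rfl⟩ - - hcu w hw hw1 hw2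
  obtain ⟨w, rfl⟩ := hbox w hw1 hw2
  simp only [hinv] at hcu
  rw [← hadj, ← hadj]
  exact (h3 u hu u' hu' hcu).2 w fun h => hw ⟨w, h, rfl⟩

theorem exists_expr_of_cliqueWidth_le {V : Type*} [Nonempty V] {G : SimpleGraph V} {c : ℕ}
    (h : cliqueWidth G ≤ c) : ∃ k ≤ c, ∃ e : CWExpr k, Nonempty (G ≃g e.graph) := by
  by_contra! hcon
  have : ((c + 1 : ℕ) : ℕ∞) ≤ cliqueWidth G := by
    refine le_iInf₂ fun k hk => ?_
    rcases hk with hk | ⟨e, ⟨φ⟩⟩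
    · exact (not_isEmpty_of_nonempty V hk).elim
    · by_contra hlt
      exact (hcon k (by have := not_le.1 hlt; norm_cast at this; omega) e).false φ
  have := this.trans h
  norm_cast at this
  omega

theorem not_boundedCliqueWidth_wordClass {α : ℕ → Fin 2}
    (hper : ∃ p : ℕ, 0 < p ∧ ∀ i, α i = α (i + p)) (hone : ∃ i, α i = 1) :
    ¬ BoundedCliqueWidth (wordClass α) := by
  rintro ⟨b, hb⟩
  obtain ⟨p, hp, hper⟩ := hper
  obtain ⟨j₀, hj₀⟩ := hone
  have hmul : ∀ t, α (j₀ + t * p) = 1 := by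
    intro t
    induction t with
    | zero => simpa using hj₀
    | succ t ih => rw [← ih, hper (j₀ + t * p)]; ring_nf
  have hinj : Function.Injective fun t => j₀ + t * p := fun s t h =>
    Nat.eq_of_mul_eq_mul_right hp (Nat.add_left_cancel h)
  let n := 2 * b * (3 * b) + 3
  let N := j₀ + (9 * b + 2) * p + 2
  have hbox := hb _ (boxGraph_mem_wordClass α n N)
  have : Nonempty (boxGraph α n N).V := ⟨((⟨0, by omega⟩ : Fin n), (⟨0, by omega⟩ : Fin N))⟩
  obtain ⟨k, hk, e, ⟨φ⟩⟩ := exists_expr_of_cliqueWidth_le hbox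
  refine (isEmpty_boxGraph_iso (N := N) ((Finset.range (9 * k + 2)).image fun t => j₀ + t * p) ?_ ?_ ?_ ?_
    e).false φ
  · intro j hj
    obtain ⟨t, ht, rfl⟩ := Finset.mem_image.1 hj
    have ht := Finset.mem_range.1 ht
    have : t * p ≤ (9 * b + 2) * p := Nat.mul_le_mul_right _ (by omega)
    exact ⟨by omega, hmul t⟩
  · rw [Finset.card_image_of_injective _ hinj, Finset.card_range]
  · omega
  · have : 2 * k * (3 * k) ≤ 2 * b * (3 * b) := Nat.mul_le_mul (by omega) (by omega)
    omega

/-! ### Linear clique-width of the proper hereditary subclasses is bounded -/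

section Sweep

variable (S : Set (ℕ × ℕ)) (m : ℕ)

/-- The rows that lie in `S` throughout the `t`-th window of `m` consecutive columns, i.e. the
columns `j` with `j / m = t`. -/
def fullRows (t : ℕ) : Set ℕ := {i | ∀ j, j / m = t → (i, j) ∈ S}

open Classical in
/-- The stage at which a vertex is created: the vertices of a window come at the stage of the
window up to the first gap of their row in this window, and one stage later after this gap. -/
noncomputable def stage (v : ℕ × ℕ) : ℕ :=
  if ∃ j < v.2, j / m = v.2 / m ∧ (v.1, j) ∉ S then v.2 / m + 1 else v.2 / m

/-- Vertices are ordered by stage, then by row, then by column. -/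
noncomputable def sweepKey (v : ℕ × ℕ) : ℕ ×ₗ ℕ ×ₗ ℕ := toLex (stage S m v, toLex v)

theorem sweepKey_injective : Function.Injective (sweepKey S m) := fun u v h => by
  have h2 : toLex u = toLex v := congrArg (fun x => (ofLex x).2) h
  exact toLex.injective h2

variable {S m}

theorem div_le_stage (v : ℕ × ℕ) : v.2 / m ≤ stage S m v := by
  unfold stage; split_ifs <;> omega

theorem stage_le_div_succ (v : ℕ × ℕ) : stage S m v ≤ v.2 / m + 1 := by
  unfold stage; split_ifs <;> omega

/-- Two consecutive vertices of a row come at the same stage, except at the end of a window in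
which the row has no gap. -/
theorem stage_succ (hm : 0 < m) {r j : ℕ} (hj : (r, j) ∈ S) :
    stage S m (r, j + 1) = stage S m (r, j) ∨
      (stage S m (r, j + 1) = stage S m (r, j) + 1 ∧ r ∈ fullRows S m (stage S m (r, j))) := by
  by_cases hdiv : (j + 1) / m = j / m
  · left
    have : (∃ j' < j + 1, j' / m = (j + 1) / m ∧ (r, j') ∉ S) ↔
        ∃ j' < j, j' / m = j / m ∧ (r, j') ∉ S := by
      rw [hdiv]
      constructor
      · rintro ⟨j', h1, h2, h3⟩
        refine ⟨j', ?_, h2, h3⟩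
        have : j' ≠ j := fun h => h3 (h ▸ hj)
        omega
      · rintro ⟨j', h1, h2⟩
        exact ⟨j', by omega, h2⟩
    unfold stage
    by_cases hgap : ∃ j' < j, j' / m = j / m ∧ (r, j') ∉ S
    · rw [if_pos (this.2 hgap), if_pos hgap, hdiv]
    · rw [if_neg (mt this.1 hgap), if_neg hgap, hdiv]
  · have hlt : j / m < (j + 1) / m :=
      lt_of_le_of_ne (Nat.div_le_div_right (Nat.le_succ j)) (Ne.symm hdiv)
    have hsucc : (j + 1) / m = j / m + 1 := by
      have : (j + 1) / m ≤ (j + m) / m := Nat.div_le_div_right (by omega)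
      rw [Nat.add_div_right _ hm] at this
      omega
    have h1 : stage S m (r, j + 1) = j / m + 1 := by
      unfold stage
      rw [if_neg, hsucc]
      rintro ⟨j', h1, h2, -⟩
      have : j' / m ≤ j / m := Nat.div_le_div_right (by simpa using Nat.le_of_lt_succ h1)
      simp only at h2
      omega
    by_cases hgap : ∃ j' < j, j' / m = j / m ∧ (r, j') ∉ S
    · left
      rw [h1, stage, if_pos hgap]
    · right
      have h2 : stage S m (r, j) = j / m := if_neg hgap
      rw [h1, h2]
      refine ⟨rfl, fun j' hj' => ?_⟩
      by_contra hcon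
      rcases lt_trichotomy j' j with h | rfl | h
      · exact hgap ⟨j', h, hj', hcon⟩
      · exact hcon hj
      · have : (j + 1) / m ≤ j' / m := Nat.div_le_div_right h
        omega

/-- At the cut after the vertex `a`, a vertex has a neighbour from its own row on the other side
only if it lies in the row of `a` or in a row that is full in the current or the previous
window. -/
theorem row_mem_of_cut (hm : 0 < m) {a u w : ℕ × ℕ} (hu : u ∈ S) (hw : w ∈ S)
    (hua : sweepKey S m u ≤ sweepKey S m a) (haw : sweepKey S m a < sweepKey S m w)
    (hrow : u.1 = w.1) (hcol : w.2 = u.2 + 1 ∨ u.2 = w.2 + 1) :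
    u.1 = a.1 ∨ u.1 ∈ fullRows S m (stage S m a) ∨ u.1 ∈ fullRows S m (stage S m a - 1) := by
  obtain ⟨r, j⟩ := u
  obtain ⟨r', j'⟩ := w
  obtain ⟨i, l⟩ := a
  simp only [sweepKey, Prod.Lex.le_iff, Prod.Lex.lt_iff, ofLex_toLex] at hua haw
  simp only at hrow hcol
  subst hrow
  rcases hcol with rfl | rfl
  · rcases stage_succ hm hu with h | ⟨h, hfull⟩
    · left
      simp only
      omega
    · right
      rcases (show stage S m (i, l) = stage S m (r, j) ∨
          stage S m (i, l) - 1 = stage S m (r, j) by omega) with h' | h' <;> rw [h']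
      · exact Or.inl hfull
      · exact Or.inr hfull
  · rcases stage_succ hm hw with h | ⟨h, -⟩
    · left
      simp only
      omega
    · omega

end Sweep

theorem linearCliqueWidth_le_of_fullRows {α : ℕ → Fin 2} {V : Type*} [Finite V]
    {G : SimpleGraph V} (φ : G ↪g wordGraph α) {m k : ℕ} (hm : 0 < m)
    (hfin : ∀ t, (fullRows (Set.range φ) m t).Finite)
    (hk : ∀ t, (fullRows (Set.range φ) m t).ncard ≤ k) :
    linearCliqueWidth G ≤
      (2 * Fintype.card (Option (Fin (2 * m + 1) × Option (Fin (2 * k + 1)))) + 1 : ℕ) := by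
  classical
  set S := Set.range φ with hS
  refine linearCliqueWidth_le_of_order G (fun v => sweepKey S m (φ v))
    ((sweepKey_injective S m).comp φ.injective) fun a => ?_
  set s := stage S m (φ a) with hs
  let E : Set ℕ := {(φ a).1} ∪ (fullRows S m s ∪ fullRows S m (s - 1))
  have hEfin : E.Finite := (Set.finite_singleton _).union ((hfin _).union (hfin _))
  have hEcard : E.ncard ≤ 2 * k + 1 := by
    have h1 := Set.ncard_union_le {(φ a).1} (fullRows S m s ∪ fullRows S m (s - 1))
    have h2 := Set.ncard_union_le (fullRows S m s) (fullRows S m (s - 1))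
    have h3 := hk s
    have h4 := hk (s - 1)
    rw [Set.ncard_singleton] at h1
    simp only [E]
    omega
  obtain ⟨g, -, hg⟩ := hEfin.exists_injOn_of_encard_le (t := (Set.univ : Set (Fin (2 * k + 1))))
    (by
      rw [← hEfin.cast_ncard_eq, Set.encard_univ]
      simpa using (by exact_mod_cast hEcard : (E.ncard : ℕ∞) ≤ (2 * k + 1 : ℕ)))
  -- Only columns from `s * m - m - 1` to `s * m + m - 1` have neighbours on both sides of the cut.
  let c : V → Option (Fin (2 * m + 1) × Option (Fin (2 * k + 1))) := fun u =>
    if (φ u).2 + m + 1 < s * m then none else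
      some (Fin.ofNat _ ((φ u).2 + m + 1 - s * m),
        if (φ u).1 ∈ E then some (g (φ u).1) else none)
  have hpre : ∀ u, sweepKey S m (φ u) ≤ sweepKey S m (φ a) → (φ u).2 < s * m + m := by
    intro u hu
    have h1 : stage S m (φ u) ≤ s := by
      simp only [sweepKey, Prod.Lex.le_iff, ofLex_toLex] at hu
      omega
    have h2 := (div_le_stage (φ u)).trans h1
    have := (Nat.div_lt_iff_lt_mul hm).1 (Nat.lt_succ_of_le h2)
    rwa [Nat.succ_mul] at this
  have hsuf : ∀ w, sweepKey S m (φ a) < sweepKey S m (φ w) → s * m ≤ (φ w).2 + m := by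
    intro w hw
    have h1 : s ≤ stage S m (φ w) := by
      simp only [sweepKey, Prod.Lex.lt_iff, ofLex_toLex] at hw
      omega
    have h2 := h1.trans (stage_le_div_succ (φ w))
    calc s * m ≤ ((φ w).2 / m + 1) * m := Nat.mul_le_mul_right _ h2
      _ = (φ w).2 / m * m + m := Nat.succ_mul _ _
      _ ≤ (φ w).2 + m := Nat.add_le_add_right (Nat.div_mul_le_self _ _) _
  have hrow : ∀ u, sweepKey S m (φ u) ≤ sweepKey S m (φ a) → (φ u).1 ∉ E → ∀ w,
      sweepKey S m (φ a) < sweepKey S m (φ w) →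
      ((φ w).2 = (φ u).2 + 1 ∨ (φ u).2 = (φ w).2 + 1) → (φ u).1 ≠ (φ w).1 := by
    intro u hu huE w hw hcol hne
    exact huE (row_mem_of_cut hm ⟨u, rfl⟩ ⟨w, rfl⟩ hu hw hne hcol)
  refine ⟨c, fun u u' hu hu' hc w hw => ?_⟩
  rw [← φ.map_adj_iff, ← φ.map_adj_iff (v := u')]
  have hu1 := hpre u hu
  have hu1' := hpre u' hu'
  have hw1 := hsuf w hw
  simp only [c] at hc
  by_cases hold : (φ u).2 + m + 1 < s * m
  · rw [if_pos hold] at hc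
    have hold' : (φ u').2 + m + 1 < s * m := by
      by_contra h
      simp [h] at hc
    rw [wordGraph_adj, wordGraph_adj]
    omega
  · rw [if_neg hold] at hc
    have hold' : ¬ (φ u').2 + m + 1 < s * m := fun h => by simp [h] at hc
    rw [if_neg hold', Option.some.injEq, Prod.mk.injEq, Fin.ext_iff] at hc
    simp only [Fin.ofNat] at hc
    rw [Nat.mod_eq_of_lt (by omega), Nat.mod_eq_of_lt (by omega)] at hc
    have hcol : (φ u).2 = (φ u').2 := by omega
    by_cases huE : (φ u).1 ∈ E
    · by_cases huE' : (φ u').1 ∈ E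
      · rw [if_pos huE, if_pos huE', Option.some.injEq] at hc
        rw [Prod.ext (hg huE huE' hc.2) hcol]
      · simp [huE, huE'] at hc
    · by_cases huE' : (φ u').1 ∈ E
      · simp [huE, huE'] at hc
      · have h1 := hrow u hu huE w hw
        have h2 := hrow u' hu' huE' w hw
        rw [wordGraph_adj, wordGraph_adj]
        rw [← hcol] at h2 ⊢
        tauto

/-- If `α` has period `m`, then `k` rows that are full in a common window of `m` columns induce
the box with `k` rows and `m` columns. -/
theorem boxGraph_isIndContained {α : ℕ → Fin 2} {V : Type*} {G : SimpleGraph V}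
    (φ : G ↪g wordGraph α) {m k t : ℕ} (hper : ∀ i, α i = α (i + m))
    (hfin : (fullRows (Set.range φ) m t).Finite) (hk : k ≤ (fullRows (Set.range φ) m t).ncard) :
    (boxGraph α k m).graph.IsIndContained G := by
  have := hfin.fintype
  obtain ⟨h⟩ : Nonempty (Fin k ↪ fullRows (Set.range φ) m t) :=
    Function.Embedding.nonempty_of_card_le (by
      rwa [Fintype.card_fin, ← Nat.card_eq_fintype_card, Nat.card_coe_set_eq])
  have hα : ∀ j, α (j + m * t) = α j := by
    intro j
    clear hfin hk h this
    induction t with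
    | zero => simp
    | succ t ih => rw [Nat.mul_succ, ← Nat.add_assoc, ← hper, ih]
  have hmem : ∀ x : Fin k × Fin m, ∃ v, φ v = ((h x.1 : ℕ), x.2.val + m * t) := fun x =>
    (h x.1).2 _ (by
      have : 0 < m := x.2.pos
      rw [Nat.add_mul_div_left _ _ this, Nat.div_eq_of_lt x.2.isLt, Nat.zero_add])
  choose ψ hψ using hmem
  have hval : ∀ i i' : Fin k, ((h i : ℕ) = h i') ↔ i.val = i'.val := fun i i' =>
    ⟨fun hh => congrArg _ (h.injective (Subtype.ext hh)), fun hh => by rw [Fin.ext hh]⟩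
  refine ⟨⟨⟨ψ, fun (x y : Fin k × Fin m) hxy => ?_⟩, fun {x y : Fin k × Fin m} => ?_⟩⟩
  · have := congrArg φ hxy
    rw [hψ, hψ, Prod.mk.injEq, hval] at this
    exact Prod.ext (Fin.ext this.1) (Fin.ext (by omega))
  · change G.Adj (ψ x) (ψ y) ↔ (wordGraph α).Adj (x.1.val, x.2.val) (y.1.val, y.2.val)
    rw [← φ.map_adj_iff, hψ, hψ, wordGraph_adj, wordGraph_adj]
    simp only [hα, ne_eq, hval]
    have e1 : y.2.val + m * t = x.2.val + m * t + 1 ↔ y.2.val = x.2.val + 1 := by omega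
    have e2 : x.2.val + m * t = y.2.val + m * t + 1 ↔ x.2.val = y.2.val + 1 := by omega
    rw [e1, e2]

/-- The boxes are universal for `wordClass α`, with a number of columns that can be chosen as a
multiple of any given `p`. -/
theorem exists_isIndContained_boxGraph {α : ℕ → Fin 2} {G : FinGraph} (hG : G ∈ wordClass α)
    {p : ℕ} (hp : 0 < p) : ∃ k b, G.graph.IsIndContained (boxGraph α k (p * (b + 1))).graph := by
  obtain ⟨φ⟩ := hG
  have := G.finite
  obtain ⟨k, hk⟩ := (Set.finite_range fun v => (φ v).1).bddAbove
  obtain ⟨b, hb⟩ := (Set.finite_range fun v => (φ v).2).bddAbove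
  have hk' : ∀ v, (φ v).1 < k + 1 := fun v => Nat.lt_succ_of_le (hk ⟨v, rfl⟩)
  have hb' : ∀ v, (φ v).2 < p * (b + 1) := fun v =>
    (Nat.lt_succ_of_le (hb ⟨v, rfl⟩)).trans_le (Nat.le_mul_of_pos_left _ hp)
  let ψ : G.V → Fin (k + 1) × Fin (p * (b + 1)) := fun v => (⟨_, hk' v⟩, ⟨_, hb' v⟩)
  refine ⟨k + 1, b, ⟨⟨⟨ψ, fun x y hxy => φ.injective ?_⟩, fun {x y} => φ.map_adj_iff⟩⟩⟩
  exact congrArg (fun z : Fin (k + 1) × Fin (p * (b + 1)) => (z.1.val, z.2.val)) hxy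

theorem boundedLinearCliqueWidth_of_ssubset {α : ℕ → Fin 2}
    (hper : ∃ p : ℕ, 0 < p ∧ ∀ i, α i = α (i + p)) {X : Set FinGraph} (hX : IsHereditary X)
    (hXα : X ⊂ wordClass α) : BoundedLinearCliqueWidth X := by
  obtain ⟨p, hp, hper⟩ := hper
  obtain ⟨hsub, hnot⟩ := hXα
  obtain ⟨G₀, hG₀, hG₀X⟩ := Set.not_subset.1 hnot
  obtain ⟨k, b, hbox⟩ := exists_isIndContained_boxGraph hG₀ hp
  have hperm : ∀ i, α i = α (i + p * (b + 1)) := by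
    intro i
    induction b + 1 with
    | zero => simp
    | succ n ih => rw [ih, hper, Nat.mul_succ, Nat.add_assoc]
  have hm : 0 < p * (b + 1) := Nat.mul_pos hp (Nat.succ_pos b)
  refine ⟨2 * Fintype.card (Option (Fin (2 * (p * (b + 1)) + 1) × Option (Fin (2 * k + 1)))) + 1,
    fun G hG => ?_⟩
  have := G.finite
  obtain ⟨φ⟩ := hsub hG
  have hfin : ∀ t, (fullRows (Set.range φ) (p * (b + 1)) t).Finite := fun t =>
    ((Set.finite_range φ).image Prod.fst).subset fun i hi =>
      ⟨(i, t * (p * (b + 1))), hi _ (Nat.mul_div_cancel _ hm), rfl⟩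
  refine linearCliqueWidth_le_of_fullRows φ hm hfin (k := k) fun t => ?_
  by_contra! hlt
  exact hG₀X (hX G hG G₀ (hbox.trans (boxGraph_isIndContained φ hperm (hfin t) hlt.le)))

theorem cliqueWidth_le_linearCliqueWidth {V : Type*} (G : SimpleGraph V) :
    cliqueWidth G ≤ linearCliqueWidth G :=
  le_iInf₂ fun k hk => iInf₂_le k (hk.imp_right fun ⟨e, _, he⟩ => ⟨e, he⟩)

theorem BoundedLinearCliqueWidth.boundedCliqueWidth {X : Set FinGraph}
    (h : BoundedLinearCliqueWidth X) : BoundedCliqueWidth X :=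
  h.imp fun _ hc G hG => (cliqueWidth_le_linearCliqueWidth _).trans (hc G hG)

/-! ### Minimality -/

theorem theorem1 (α : ℕ → Fin 2) (hper : ∃ p : ℕ, 0 < p ∧ ∀ i, α i = α (i + p))
    (hone : ∃ i, α i = 1) :
    Minimal (fun X : Set FinGraph => IsHereditary X ∧ ¬ BoundedCliqueWidth X) (wordClass α) ∧
    Minimal (fun X : Set FinGraph => IsHereditary X ∧ ¬ BoundedLinearCliqueWidth X)
      (wordClass α) ∧
    ∀ X : Set FinGraph, IsHereditary X → X ⊂ wordClass α → BoundedLinearCliqueWidth X := by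
  have hher : IsHereditary (wordClass α) := fun _ hG _ hH => hH.trans hG
  have hcw := not_boundedCliqueWidth_wordClass hper hone
  have hsub : ∀ X : Set FinGraph, IsHereditary X → X ⊂ wordClass α → BoundedLinearCliqueWidth X :=
    fun X hX => boundedLinearCliqueWidth_of_ssubset hper hX
  refine ⟨⟨⟨hher, hcw⟩, fun X hX hle => ?_⟩, ⟨⟨hher, fun h => hcw h.boundedCliqueWidth⟩,
    fun X hX hle => ?_⟩, hsub⟩
  · by_contra hnot
    exact hX.2 (hsub X hX.1 ⟨hle, hnot⟩).boundedCliqueWidth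
  · by_contra hnot
    exact hX.2 (hsub X hX.1 ⟨hle, hnot⟩)
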